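/- Let $T,\bar\sigma\in(0,\infty)$, let $(\Omega,\mathcal F,\mathbb P)$ be a probability space, and let $\xi^{l,k}\colon\Omega\to\mathbb R$, $l\in\mathbb N_0=\{0,1,2,\dots\}$, $k\in\mathbb N=\{1,2,\dots\}$, be an independent family of normally distributed random variables with mean zero and standard deviation $\bar\sigma$. Let $X\colon[0,T]\times\Omega\to\mathbb R$ be a stochastic process with continuous sample paths which solves $$dX_t=-X_t^5\,dt\quad(t\in[0,T]),\qquad X_0=\xi,$$ where $\xi\colon\Omega\to\mathbb R$ is normally distributed with mean zero and standard deviation $\bar\sigma$. For $N\in\mathbb N$, $l\in\mathbb N_0$, $k\in\mathbb N$ let $Y^{N,l,k}_n\colon\Omega\to\mathbb R$, $n\in\{0,1,\dots,N\}$, be the explicit Euler approximations given by $Y^{N,l,k}_0=\xi^{l,k}$ and $$Y^{N,l,k}_{n+1}=Y^{N,l,k}_n-\bigl(Y^{N,l,k}_n\bigr)^5\cdot\frac TN ,\qquad n\in\{0,1,\dots,N-1\}.$$ For $p\in(0,\infty)$ and $N\in\{2^1,2^2,2^3,\dots\}$ let $$E_{N,p}=\frac1N\sum_{k=1}^{N}\bigl|Y^{1,0,k}_1\bigr|^p+\sum_{l=1}^{\log_2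 N}\frac{2^l}{N}\sum_{k=1}^{N/2^l}\Bigl(\bigl|Y^{2^l,l,k}_{2^l}\bigr|^p-\bigl|Y^{2^{l-1},l,k}_{2^{l-1}}\bigr|^p\Bigr)$$ be the multilevel Monte Carlo Euler estimator of $\mathbb E\bigl[|X_T|^p\bigr]$. Then for every $p\in(0,\infty)$ it holds $\mathbb P$-almost surely that $$\lim_{n\to\infty}\bigl|E_{2^n,p}\bigr|=\infty .$$ In particular, $\mathbb E\bigl[|X_T|^p\bigr]<\infty$, but $E_{2^n,p}$ does not converge in probability to $\mathbb E\bigl[|X_T|^p\bigr]$ as $n\to\infty$; that is, the estimator is not consistent. -/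

import Mathlib

open MeasureTheory ProbabilityTheory Filter Topology

noncomputable section

/-- The explicit Euler scheme with `N` time steps on `[0, T]` for `dX = -X ^ 5 dt` started in `x`:
`y 0 = x` and `y (n + 1) = y n - (y n) ^ 5 * (T / N)`. -/
def eulerScheme (T : ℝ) (N : ℕ) (x : ℝ) : ℕ → ℝ
  | 0 => x
  | n + 1 => eulerScheme T N x n - eulerScheme T N x n ^ 5 * (T / N)

/-- The multilevel Monte Carlo Euler estimator of `E[|X_T| ^ p]` with `N` a power of two, for which
`Nat.log 2 N` is the exact binary logarithm and `N / 2 ^ l` is an exact quotient for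
`l ≤ Nat.log 2 N`. On level `l` it uses the samples `ξ l k`; the sample index `k` starts at `0`. -/
def mlmcEuler {Ω : Type*} (T p : ℝ) (ξ : ℕ → ℕ → Ω → ℝ) (N : ℕ) (ω : Ω) : ℝ :=
  (1 / (N : ℝ)) * ∑ k ∈ Finset.range N, |eulerScheme T 1 (ξ 0 k ω) 1| ^ p
    + ∑ l ∈ Finset.Icc 1 (Nat.log 2 N), ((2 : ℝ) ^ l / (N : ℝ)) *
        ∑ k ∈ Finset.range (N / 2 ^ l),
          (|eulerScheme T (2 ^ l) (ξ l k ω) (2 ^ l)| ^ p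
            - |eulerScheme T (2 ^ (l - 1)) (ξ l k ω) (2 ^ (l - 1))| ^ p)

/-- `X` is a real stochastic process on `[0, T]` with continuous sample paths which solves
`dX_t = -X_t ^ 5 dt`, `X_0 = ξ₀` (in integrated form, almost surely). Values of `X` at times
outside `[0, T]` play no role. -/
structure IsQuinticSolution {Ω : Type*} [MeasurableSpace Ω] (P : Measure Ω) (T : ℝ)
    (ξ₀ : Ω → ℝ) (X : ℝ → Ω → ℝ) : Prop where
  measurable : ∀ t ∈ Set.Icc (0 : ℝ) T, Measurable (X t)
  continuousOn : ∀ ω, ContinuousOn (fun t => X t ω) (Set.Icc 0 T)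
  integral_eq : ∀ᵐ ω ∂P, ∀ t ∈ Set.Icc (0 : ℝ) T,
    X t ω = ξ₀ ω + ∫ s in (0 : ℝ)..t, -(X s ω) ^ 5

end

section Euler

variable {T : ℝ} {N : ℕ}

lemma eulerScheme_succ (T : ℝ) (N : ℕ) (x : ℝ) (n : ℕ) :
    eulerScheme T N x (n + 1) =
      eulerScheme T N x n - eulerScheme T N x n ^ 5 * (T / N) := rfl

lemma abs_eulerScheme_succ (T : ℝ) (N : ℕ) (x : ℝ) (n : ℕ) :
    |eulerScheme T N x (n + 1)| =
      |eulerScheme T N x n| * |eulerScheme T N x n ^ 4 * (T / N) - 1| := by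
  rw [eulerScheme_succ, ← abs_mul, ← abs_neg]
  congr 1
  ring

lemma abs_eulerScheme_le (hT : 0 ≤ T) {x : ℝ} (hx : x ^ 4 * (T / N) ≤ 2) (n : ℕ) :
    |eulerScheme T N x n| ≤ |x| := by
  induction n with
  | zero => exact le_rfl
  | succ n ih =>
    have hc : 0 ≤ T / N := by positivity
    have h4 : eulerScheme T N x n ^ 4 ≤ x ^ 4 := by
      have := pow_le_pow_left₀ (abs_nonneg _) ih 4
      rwa [Even.pow_abs (by decide), Even.pow_abs (by decide)] at this
    have h1 : |eulerScheme T N x n ^ 4 * (T / N) - 1| ≤ 1 := by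
      have h0 : 0 ≤ eulerScheme T N x n ^ 4 * (T / N) := by positivity
      have h2 := (mul_le_mul_of_nonneg_right h4 hc).trans hx
      rw [abs_le]
      constructor <;> linarith
    rw [abs_eulerScheme_succ]
    exact (mul_le_of_le_one_right (abs_nonneg _) h1).trans ih

lemma abs_le_abs_eulerScheme (hT : 0 ≤ T) {x : ℝ} (hx : 2 ≤ x ^ 4 * (T / N)) (n : ℕ) :
    |x| ≤ |eulerScheme T N x n| := by
  induction n with
  | zero => exact le_rfl
  | succ n ih =>
    have hc : 0 ≤ T / N := by positivity
    have h4 : x ^ 4 ≤ eulerScheme T N x n ^ 4 := by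
      have := pow_le_pow_left₀ (abs_nonneg _) ih 4
      rwa [Even.pow_abs (by decide), Even.pow_abs (by decide)] at this
    have h1 : 1 ≤ |eulerScheme T N x n ^ 4 * (T / N) - 1| := by
      have h2 := hx.trans (mul_le_mul_of_nonneg_right h4 hc)
      exact le_abs.2 (Or.inl (by linarith))
    rw [abs_eulerScheme_succ]
    exact ih.trans (le_mul_of_one_le_right (abs_nonneg _) h1)

/-- Above the critical threshold, the ratio of two Euler paths is raised at least to its fifth
power in every step. -/
lemma pow_mul_abs_eulerScheme_le (hT : 0 ≤ T) {x z b : ℝ} (hb : 1 ≤ b)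
    (hx : 2 ≤ x ^ 4 * (T / N)) (hz : b * |x| ≤ |z|) (n : ℕ) :
    b ^ 5 ^ n * |eulerScheme T N x n| ≤ |eulerScheme T N z n| := by
  induction n with
  | zero => simpa [eulerScheme] using hz
  | succ n ih =>
    have hc : 0 ≤ T / N := by positivity
    set u := eulerScheme T N x n
    set v := eulerScheme T N z n
    set B := b ^ 5 ^ n
    have hB : 1 ≤ B := one_le_pow₀ hb
    have hB4 : 1 ≤ B ^ 4 := one_le_pow₀ hB
    have h4 : x ^ 4 ≤ u ^ 4 := by
      have := pow_le_pow_left₀ (abs_nonneg _) (abs_le_abs_eulerScheme hT hx n) 4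
      rwa [Even.pow_abs (by decide), Even.pow_abs (by decide)] at this
    have h5 : B ^ 4 * u ^ 4 ≤ v ^ 4 := by
      have := pow_le_pow_left₀ (by positivity) ih 4
      rwa [mul_pow, Even.pow_abs (by decide), Even.pow_abs (by decide)] at this
    have hu : 2 ≤ u ^ 4 * (T / N) := hx.trans (mul_le_mul_of_nonneg_right h4 hc)
    have h6 : B ^ 4 * (u ^ 4 * (T / N)) ≤ v ^ 4 * (T / N) := by
      rw [← mul_assoc]; exact mul_le_mul_of_nonneg_right h5 hc
    have h7 : B ^ 4 * |u ^ 4 * (T / N) - 1| ≤ |v ^ 4 * (T / N) - 1| := by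
      rw [abs_of_nonneg (by linarith)]
      refine le_trans ?_ (le_abs_self _)
      linarith
    rw [abs_eulerScheme_succ, abs_eulerScheme_succ, pow_succ, pow_mul]
    calc B ^ 5 * (|u| * |u ^ 4 * (T / N) - 1|)
        = (B * |u|) * (B ^ 4 * |u ^ 4 * (T / N) - 1|) := by ring
      _ ≤ |v| * |v ^ 4 * (T / N) - 1| := by gcongr

lemma abs_eulerScheme_le_pow (hT : 0 ≤ T) {x b : ℝ} (hb : 1 ≤ b) (hx : |x| ≤ b) (n : ℕ) :
    |eulerScheme T N x n| ≤ ((1 + T) * b) ^ 5 ^ n := by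
  suffices h : (1 + T) * max 1 |eulerScheme T N x n| ≤ ((1 + T) * b) ^ 5 ^ n by
    refine le_trans ?_ h
    have := le_max_right 1 |eulerScheme T N x n|
    nlinarith [abs_nonneg (eulerScheme T N x n)]
  induction n with
  | zero =>
    have : max 1 |x| ≤ b := max_le hb hx
    simpa [eulerScheme] using mul_le_mul_of_nonneg_left this (by linarith : 0 ≤ 1 + T)
  | succ n ih =>
    set y := max 1 |eulerScheme T N x n|
    have hy : 1 ≤ y := le_max_left _ _
    have hTN : T / N ≤ T := by
      rcases Nat.eq_zero_or_pos N with rfl | h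
      · simpa using hT
      · exact div_le_self hT (by exact_mod_cast h)
    have hc : 0 ≤ T / N := by positivity
    have hy5 : y ≤ y ^ 5 := le_self_pow₀ hy (by decide)
    have h1 : |eulerScheme T N x (n + 1)| ≤ (1 + T) * y ^ 5 := by
      rw [eulerScheme_succ]
      refine (abs_sub _ _).trans ?_
      rw [abs_mul, abs_pow, abs_of_nonneg hc]
      have h2 : |eulerScheme T N x n| ≤ y := le_max_right _ _
      calc _ ≤ y ^ 5 + y ^ 5 * T := by gcongr; exact h2.trans hy5
        _ = _ := by ring
    have h2 : max 1 |eulerScheme T N x (n + 1)| ≤ (1 + T) * y ^ 5 := by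
      refine max_le ?_ h1
      nlinarith [one_le_pow₀ hy (n := 5)]
    rw [pow_succ, pow_mul]
    calc (1 + T) * max 1 |eulerScheme T N x (n + 1)| ≤ (1 + T) * ((1 + T) * y ^ 5) := by gcongr
      _ = (1 + T) ^ 2 * y ^ 5 := by ring
      _ ≤ (1 + T) ^ 5 * y ^ 5 := by gcongr <;> linarith
      _ = ((1 + T) * y) ^ 5 := by ring
      _ ≤ _ := by gcongr

/-- The threshold below which the Euler scheme with `N` steps contracts and above which it
explodes. -/
noncomputable def eulerThreshold (T : ℝ) (N : ℕ) : ℝ := √(√(2 * N / T))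

lemma eulerThreshold_nonneg (T : ℝ) (N : ℕ) : 0 ≤ eulerThreshold T N := Real.sqrt_nonneg _

lemma eulerThreshold_pow_four (hT : 0 < T) (hN : 0 < N) :
    eulerThreshold T N ^ 4 * (T / N) = 2 := by
  have hN' : (0 : ℝ) < N := by exact_mod_cast hN
  rw [eulerThreshold, show (4 : ℕ) = 2 * 2 from rfl, pow_mul, Real.sq_sqrt (Real.sqrt_nonneg _),
    Real.sq_sqrt (by positivity)]
  field_simp

lemma one_le_eulerThreshold (hT : 0 < T) (hN : T ≤ N) : 1 ≤ eulerThreshold T N := by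
  rw [eulerThreshold, Real.one_le_sqrt, Real.one_le_sqrt, one_le_div hT]
  linarith

lemma pow_four_mul_le_of_abs_le_eulerThreshold (hT : 0 < T) (hN : 0 < N) {x : ℝ}
    (hx : |x| ≤ eulerThreshold T N) : x ^ 4 * (T / N) ≤ 2 := by
  rw [← eulerThreshold_pow_four hT hN, ← Even.pow_abs (by decide : Even 4) x]
  gcongr

lemma le_pow_four_mul_of_eulerThreshold_le_abs (hT : 0 < T) (hN : 0 < N) {x : ℝ}
    (hx : eulerThreshold T N ≤ |x|) : 2 ≤ x ^ 4 * (T / N) := by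
  rw [← eulerThreshold_pow_four hT hN, ← Even.pow_abs (by decide : Even 4) x]
  have := eulerThreshold_nonneg T N
  gcongr

end Euler

section Growth

/-- For `D ≥ 625 ^ n` the quantity `(1 + 128⁻ⁿ) ^ D²` eventually dominates
`(2 * 64 ^ n) ^ (1 / p) * ((1 + T) * 4 ^ n) ^ D`. -/
lemma eventually_rpow_mul_pow_le (T p : ℝ) (hT : 0 < T) (hp : 0 < p) :
    ∀ᶠ n : ℕ in atTop, ∀ D : ℕ, 625 ^ n ≤ D →
      ((2 * 64 ^ n : ℝ) ^ (1 / p)) * ((1 + T) * 4 ^ n) ^ D ≤ (1 + (1 / 128) ^ n : ℝ) ^ D ^ 2 := by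
  have hlim : Tendsto (fun n : ℕ => (n : ℝ) * (128 / 625 : ℝ) ^ n) atTop (𝓝 0) :=
    tendsto_self_mul_const_pow_of_lt_one (by norm_num) (by norm_num)
  set K : ℝ := (1 + 64) / p + T + 4 with hK
  have hKpos : 0 < K := by positivity
  filter_upwards [hlim.eventually (gt_mem_nhds (show (0 : ℝ) < 1 / (2 * K) by positivity)),
    eventually_ge_atTop 1] with n hn hn1 D hD
  have hn1' : (1 : ℝ) ≤ n := by exact_mod_cast hn1
  have hD' : (625 : ℝ) ^ n ≤ D := by exact_mod_cast hD
  have hD0 : (1 : ℝ) ≤ D := (one_le_pow₀ (by norm_num)).trans hD'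
  have hx : (0 : ℝ) < (1 / 128) ^ n := by positivity
  have hx1 : ((1 : ℝ) / 128) ^ n ≤ 1 := pow_le_one₀ (by norm_num) (by norm_num)
  rw [← Real.log_le_log_iff (by positivity) (by positivity),
    Real.log_mul (by positivity) (by positivity), Real.log_rpow (by positivity), Real.log_pow,
    Real.log_pow, Real.log_mul (by norm_num) (by positivity), Real.log_pow,
    Real.log_mul (by positivity) (by positivity), Real.log_pow]
  have l2 : Real.log 2 ≤ 1 := by linarith [Real.log_le_sub_one_of_pos (show (0 : ℝ) < 2 by norm_num)]
  have l64 : Real.log 64 ≤ 64 := by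
    linarith [Real.log_le_sub_one_of_pos (show (0 : ℝ) < 64 by norm_num)]
  have l4 : Real.log 4 ≤ 4 := by
    linarith [Real.log_le_sub_one_of_pos (show (0 : ℝ) < 4 by norm_num)]
  have lT : Real.log (1 + T) ≤ T := by
    linarith [Real.log_le_sub_one_of_pos (show (0 : ℝ) < 1 + T by positivity)]
  have hlog : ((1 : ℝ) / 128) ^ n / 2 ≤ Real.log (1 + (1 / 128) ^ n) := by
    have := Real.one_sub_inv_le_log_of_pos (show (0 : ℝ) < 1 + (1 / 128) ^ n by positivity)
    refine le_trans ?_ this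
    rw [div_le_iff₀ (by norm_num), sub_mul, le_sub_iff_add_le, ← le_sub_iff_add_le',
      inv_mul_le_iff₀ (by positivity)]
    nlinarith
  have h1 : 1 / p * (Real.log 2 + n * Real.log 64) + D * (Real.log (1 + T) + n * Real.log 4)
      ≤ D * (n * K) := by
    calc _ ≤ 1 / p * (n * 1 + n * 64) + D * (n * T + n * 4) := by
          gcongr <;> nlinarith
      _ ≤ D * (1 / p * (n * 1 + n * 64)) + D * (n * T + n * 4) := by
          exact add_le_add_left (le_mul_of_one_le_left (by positivity) hD0) _
      _ = _ := by rw [hK]; ring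
  refine h1.trans ?_
  push_cast
  have h2 : (n : ℝ) * K ≤ (625 / 128) ^ n / 2 := by
    have h3 : (n : ℝ) * (128 / 625) ^ n * (2 * K) < 1 := by rwa [lt_div_iff₀ (by positivity)] at hn
    have h4 : ((128 : ℝ) / 625) ^ n * (625 / 128) ^ n = 1 := by
      rw [← mul_pow]; norm_num
    have h5 : (0 : ℝ) < (625 / 128) ^ n := by positivity
    nlinarith
  calc (D : ℝ) * (n * K) ≤ D * ((625 / 128) ^ n / 2) := by gcongr
    _ = D * (625 ^ n * ((1 / 128) ^ n / 2)) := by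
        rw [show (625 / 128 : ℝ) = 625 * (1 / 128) by norm_num, mul_pow]; ring
    _ ≤ D * (D * ((1 / 128) ^ n / 2)) := by gcongr
    _ = (D : ℝ) ^ 2 * ((1 / 128) ^ n / 2) := by ring
    _ ≤ _ := by gcongr

end Growth

section SignedSum

lemma half_le_abs_sum {ι : Type*} [DecidableEq ι] {s : Finset ι} {w F : ι → ℝ} {i₀ : ι}
    (hi₀ : i₀ ∈ s) (hw : 1 ≤ |w i₀|) (hF : 0 ≤ F i₀)
    (h : ∀ i ∈ s, i ≠ i₀ → 2 * s.card * |w i * F i| ≤ F i₀) :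
    F i₀ / 2 ≤ |∑ i ∈ s, w i * F i| := by
  have hs : (0 : ℝ) < s.card := by exact_mod_cast Finset.card_pos.2 ⟨i₀, hi₀⟩
  have h1 : |∑ i ∈ s.erase i₀, w i * F i| ≤ F i₀ / 2 := by
    calc |∑ i ∈ s.erase i₀, w i * F i| ≤ ∑ i ∈ s.erase i₀, |w i * F i| :=
          Finset.abs_sum_le_sum_abs _ _
      _ ≤ ∑ i ∈ s.erase i₀, F i₀ / (2 * s.card) := by
          refine Finset.sum_le_sum fun i hi => ?_
          rw [le_div_iff₀ (by positivity), mul_comm]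
          exact h i (Finset.mem_of_mem_erase hi) (Finset.ne_of_mem_erase hi)
      _ ≤ ∑ i ∈ s, F i₀ / (2 * s.card) :=
          Finset.sum_le_sum_of_subset_of_nonneg (Finset.erase_subset _ _)
            fun _ _ _ => by positivity
      _ = F i₀ / 2 := by
          rw [Finset.sum_const, nsmul_eq_mul]; field_simp
  have h2 : F i₀ ≤ |w i₀ * F i₀| := by
    rw [abs_mul, abs_of_nonneg hF]
    exact le_mul_of_one_le_left hF hw
  rw [← Finset.add_sum_erase s _ hi₀]
  have := abs_sub_abs_le_abs_sub (w i₀ * F i₀) (-∑ i ∈ s.erase i₀, w i * F i)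
  rw [abs_neg, sub_neg_eq_add] at this
  linarith

end SignedSum

section Estimator

/-- The weight with which the approximation with `2 ^ j` steps of a level `l` sample enters the
multilevel estimator. -/
def levelWeight (l j : ℕ) : ℝ := if j = l then 2 ^ l else if j + 1 = l then -2 ^ l else 0

lemma abs_levelWeight_le {n l : ℕ} (hl : l ≤ n) (j : ℕ) : |levelWeight l j| ≤ 2 ^ n := by
  have : (2 : ℝ) ^ l ≤ 2 ^ n := pow_le_pow_right₀ (by norm_num) hl
  unfold levelWeight
  split_ifs <;> simp [this]

/-- The indices `⟨l, k, j⟩` of the terms of the multilevel estimator with top level `n`: sample `k`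
on level `l`, approximated with `2 ^ j` steps. -/
def mlmcIndex (n : ℕ) : Finset (Σ _ : ℕ, ℕ × ℕ) :=
  (Finset.range (n + 1)).sigma fun l => Finset.range (2 ^ (n - l)) ×ˢ Finset.range (n + 1)

lemma mem_mlmcIndex {n l k j : ℕ} :
    (⟨l, k, j⟩ : Σ _ : ℕ, ℕ × ℕ) ∈ mlmcIndex n ↔ l ≤ n ∧ k < 2 ^ (n - l) ∧ j ≤ n := by
  simp [mlmcIndex]

lemma card_mlmcIndex_le (n : ℕ) : (mlmcIndex n).card ≤ 8 ^ n := by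
  have hn : n + 1 ≤ 2 ^ n := Nat.lt_two_pow_self
  calc (mlmcIndex n).card = ∑ l ∈ Finset.range (n + 1), 2 ^ (n - l) * (n + 1) := by
        simp [mlmcIndex, Finset.card_sigma]
    _ ≤ ∑ l ∈ Finset.range (n + 1), 2 ^ n * 2 ^ n := by
        refine Finset.sum_le_sum fun l _ => ?_
        gcongr
        · norm_num
        · omega
    _ ≤ 2 ^ n * (2 ^ n * 2 ^ n) := by
        rw [Finset.sum_const, Finset.card_range, smul_eq_mul]
        exact Nat.mul_le_mul_right _ hn
    _ = 8 ^ n := by rw [← mul_pow, ← mul_pow]; norm_num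

lemma sum_levelWeight_mul {n l : ℕ} (hl : l ≤ n) (f : ℕ → ℝ) :
    ∑ j ∈ Finset.range (n + 1), levelWeight l j * f j =
      2 ^ l * (f l - if l = 0 then 0 else f (l - 1)) := by
  rcases Nat.eq_zero_or_pos l with rfl | h
  · simp [levelWeight]
  · have h1 : ∀ j, levelWeight l j * f j =
        (if j = l then 2 ^ l * f j else 0) + if j = l - 1 then -2 ^ l * f j else 0 := by
      intro j
      unfold levelWeight
      by_cases h1 : j = l
      · rw [if_pos h1, if_pos h1, if_neg (by omega)]; ring
      · rw [if_neg h1, if_neg h1]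
        by_cases h2 : j + 1 = l
        · rw [if_pos h2, if_pos (by omega)]; ring
        · rw [if_neg h2, if_neg (by omega)]; ring
    simp_rw [h1]
    rw [Finset.sum_add_distrib, Finset.sum_ite_eq', Finset.sum_ite_eq',
      if_pos (by simp; omega), if_pos (by simp; omega), if_neg (by omega)]
    ring

lemma two_pow_mul_mlmcEuler {Ω : Type*} (T p : ℝ) (ξ : ℕ → ℕ → Ω → ℝ) (n : ℕ) (ω : Ω) :
    2 ^ n * mlmcEuler T p ξ (2 ^ n) ω = ∑ x ∈ mlmcIndex n, levelWeight x.1 x.2.2 *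
      |eulerScheme T (2 ^ x.2.2) (ξ x.1 x.2.1 ω) (2 ^ x.2.2)| ^ p := by
  unfold mlmcIndex
  rw [Finset.sum_sigma]
  simp_rw [Finset.sum_product]
  have h1 : ∀ l ∈ Finset.range (n + 1), ∑ k ∈ Finset.range (2 ^ (n - l)),
      ∑ j ∈ Finset.range (n + 1), levelWeight l j *
        |eulerScheme T (2 ^ j) (ξ l k ω) (2 ^ j)| ^ p =
      2 ^ l * ∑ k ∈ Finset.range (2 ^ (n - l)),
        (|eulerScheme T (2 ^ l) (ξ l k ω) (2 ^ l)| ^ p - if l = 0 then 0 else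
          |eulerScheme T (2 ^ (l - 1)) (ξ l k ω) (2 ^ (l - 1))| ^ p) := by
    intro l hl
    rw [Finset.mul_sum]
    refine Finset.sum_congr rfl fun k _ => ?_
    exact sum_levelWeight_mul (Nat.lt_succ_iff.1 (Finset.mem_range.1 hl))
      fun j => |eulerScheme T (2 ^ j) (ξ l k ω) (2 ^ j)| ^ p
  rw [Finset.sum_congr rfl h1, Finset.range_eq_Ico, Finset.sum_eq_sum_Ico_succ_bot (by omega)]
  unfold mlmcEuler
  rw [Nat.log_pow (by norm_num), mul_add]
  congr 1
  · push_cast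
    rw [← mul_assoc, mul_one_div_cancel (by positivity)]
    simp
  · rw [show Finset.Ico (0 + 1) (n + 1) = Finset.Icc 1 n from rfl, Finset.mul_sum]
    refine Finset.sum_congr rfl fun l hl => ?_
    rw [Finset.mem_Icc] at hl
    rw [Nat.pow_div hl.2 (by norm_num), ← mul_assoc]
    push_cast
    rw [mul_div_cancel₀ _ (by positivity)]
    simp [Nat.ne_of_gt hl.1]

/-- Samples for which the multilevel estimator with top level `n` is dominated by one term. -/
structure IsSpread (T : ℝ) (n : ℕ) (u : ℕ → ℕ → ℝ) : Prop where
  abs_le : ∀ l ≤ n, ∀ k < 2 ^ n, |u l k| ≤ 4 ^ n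
  separated : ∀ l ≤ n, ∀ k < 2 ^ n, ∀ l' ≤ n, ∀ k' < 2 ^ n, (l, k) ≠ (l', k') →
    (1 / 32) ^ n ≤ |(|u l k| - |u l' k'|)|
  threshold : ∀ j ≤ n, ∀ l ≤ n, ∀ k < 2 ^ n,
    (1 / 32) ^ n ≤ |(|u l k| - eulerThreshold T (2 ^ j))|
  exceeds : ∃ l ≤ n, 8 * n ≤ 2 ^ l ∧ ∃ k < 2 ^ (n - l), eulerThreshold T (2 ^ l) < |u l k|

lemma one_add_mul_le_of_add_le {n : ℕ} {x y : ℝ} (hy : y ≤ 4 ^ n)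
    (h : x + (1 / 32) ^ n ≤ y) : (1 + (1 / 128) ^ n) * x ≤ y := by
  have h1 : (1 / 128 : ℝ) ^ n * x ≤ (1 / 128 : ℝ) ^ n * 4 ^ n := by
    gcongr
    have : (0 : ℝ) < (1 / 32) ^ n := by positivity
    linarith
  rw [← mul_pow, show (1 / 128 * 4 : ℝ) = 1 / 32 by norm_num] at h1
  linarith

lemma IsSpread.exists_dominant {T : ℝ} (hT : 0 < T) {n : ℕ} (hn : T ≤ 8 * n) (hn0 : 0 < n)
    {u : ℕ → ℕ → ℝ} (hu : IsSpread T n u) {h : ℝ} (hh : 1 ≤ h)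
    (hD : ∀ D : ℕ, 625 ^ n ≤ D →
      h * ((1 + T) * 4 ^ n) ^ D ≤ (1 + (1 / 128) ^ n : ℝ) ^ D ^ 2) :
    ∃ x ∈ mlmcIndex n, levelWeight x.1 x.2.2 ≠ 0 ∧
      h ≤ |eulerScheme T (2 ^ x.2.2) (u x.1 x.2.1) (2 ^ x.2.2)| ∧
      ∀ y ∈ mlmcIndex n, levelWeight y.1 y.2.2 ≠ 0 → y ≠ x →
        h * |eulerScheme T (2 ^ y.2.2) (u y.1 y.2.1) (2 ^ y.2.2)| ≤
          |eulerScheme T (2 ^ x.2.2) (u x.1 x.2.1) (2 ^ x.2.2)| := by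
  classical
  have hkn : ∀ {l k : ℕ}, k < 2 ^ (n - l) → k < 2 ^ n := fun hk =>
    hk.trans_le (Nat.pow_le_pow_right (by norm_num) (Nat.sub_le _ _))
  -- the terms whose initial value lies above the threshold
  set S := (mlmcIndex n).filter fun x => levelWeight x.1 x.2.2 ≠ 0 ∧
    eulerThreshold T (2 ^ x.2.2) < |u x.1 x.2.1| with hS
  obtain ⟨l₀, hl₀, hl₀n, k₀, hk₀, hlk₀⟩ := hu.exceeds
  have hx₀ : (⟨l₀, k₀, l₀⟩ : Σ _ : ℕ, ℕ × ℕ) ∈ S := by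
    rw [hS, Finset.mem_filter, mem_mlmcIndex]
    exact ⟨⟨hl₀, hk₀, hl₀⟩, by simp [levelWeight], hlk₀⟩
  obtain ⟨x₁, hx₁, hmax₁⟩ := S.exists_max_image (fun x => x.2.2) ⟨_, hx₀⟩
  obtain ⟨L, hL⟩ : ∃ L, x₁.2.2 = L := ⟨_, rfl⟩
  rw [hL] at hmax₁
  obtain ⟨x, hx, hmax⟩ := (S.filter fun x => x.2.2 = L).exists_max_image
    (fun x => |u x.1 x.2.1|) ⟨x₁, by simp [hx₁, hL]⟩
  obtain ⟨l, k, j⟩ := x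
  simp only [Finset.mem_filter] at hx hmax
  obtain ⟨hxS, rfl⟩ := hx
  have hxS' := hxS
  rw [hS, Finset.mem_filter, mem_mlmcIndex] at hxS'
  obtain ⟨⟨hln, hkl, hjn⟩, hw, hthr⟩ := hxS'
  dsimp only at hw hthr hmax
  have h8 : 8 * n ≤ 2 ^ j :=
    hl₀n.trans (Nat.pow_le_pow_right (by norm_num) (hmax₁ _ hx₀))
  have hj : j ≠ 0 := by
    rintro rfl
    omega
  obtain ⟨i, rfl⟩ := Nat.exists_eq_succ_of_ne_zero hj
  rw [Nat.succ_eq_add_one] at *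
  -- the dominant term
  set M := |u l k| with hM
  set f := |eulerScheme T (2 ^ (i + 1)) (u l k) (2 ^ (i + 1))| with hf
  set D : ℕ := 5 ^ 2 ^ i with hDdef
  have hDsq : 5 ^ 2 ^ (i + 1) = D ^ 2 := by rw [hDdef, ← pow_mul, pow_succ]
  have hD625 : 625 ^ n ≤ D := by
    rw [show 625 = 5 ^ 4 by norm_num, ← pow_mul]
    exact Nat.pow_le_pow_right (by norm_num) (by rw [pow_succ] at h8; omega)
  have hD1 : 1 ≤ D := Nat.one_le_pow _ _ (by norm_num)
  set B : ℝ := ((1 + T) * 4 ^ n) ^ D with hB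
  have hBbase : (1 : ℝ) ≤ (1 + T) * 4 ^ n := by
    have : (1 : ℝ) ≤ 4 ^ n := one_le_pow₀ (by norm_num)
    nlinarith
  have h4B : (4 : ℝ) ^ n ≤ B := by
    have : (4 : ℝ) ^ n ≤ (1 + T) * 4 ^ n := le_mul_of_one_le_left (by positivity) (by linarith)
    exact this.trans (le_self_pow₀ hBbase (by omega))
  have hB1 : 1 ≤ B := one_le_pow₀ hBbase
  have hDB := hD D hD625
  set a : ℝ := 1 + (1 / 128) ^ n with ha
  have ha1 : 1 ≤ a := by rw [ha]; simp
  have hN : ∀ m, 0 < 2 ^ m := fun m => by positivity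
  have hM4 : M ≤ 4 ^ n := hu.abs_le l hln k (hkn hkl)
  have hr1 : 1 ≤ eulerThreshold T (2 ^ (i + 1)) := by
    refine one_le_eulerThreshold hT (hn.trans ?_)
    exact_mod_cast h8
  have hr0 := eulerThreshold_nonneg T (2 ^ (i + 1))
  have hfB : h * B ≤ f := by
    have h1 := hu.threshold (i + 1) hjn l hln k (hkn hkl)
    rw [abs_of_pos (sub_pos.2 hthr), le_sub_iff_add_le'] at h1
    have h2 := one_add_mul_le_of_add_le hM4 h1
    have h3 := le_pow_four_mul_of_eulerThreshold_le_abs hT (hN (i + 1))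
      (x := eulerThreshold T (2 ^ (i + 1))) (le_abs_self _)
    have h4 := pow_mul_abs_eulerScheme_le hT.le ha1 h3 (z := u l k)
      (by rwa [abs_of_nonneg hr0]) (2 ^ (i + 1))
    have h5 := abs_le_abs_eulerScheme hT.le h3 (2 ^ (i + 1))
    rw [abs_of_nonneg hr0] at h5
    rw [hDsq] at h4
    refine (hDB.trans ?_).trans h4
    exact le_mul_of_one_le_right (by positivity) (hr1.trans h5)
  refine ⟨⟨l, k, i + 1⟩, mem_mlmcIndex.2 ⟨hln, hkl, hjn⟩, hw, ?_, ?_⟩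
  · exact (le_mul_of_one_le_right (by linarith) hB1).trans hfB
  rintro ⟨l', k', j'⟩ hy hwy hne
  dsimp only at hwy ⊢
  have hyJ := hy
  rw [mem_mlmcIndex] at hy
  obtain ⟨hln', hkl', hjn'⟩ := hy
  have hu4 := hu.abs_le l' hln' k' (hkn hkl')
  have key : |eulerScheme T (2 ^ j') (u l' k') (2 ^ j')| ≤ B →
      h * |eulerScheme T (2 ^ j') (u l' k') (2 ^ j')| ≤ f := fun h1 =>
    (mul_le_mul_of_nonneg_left h1 (by linarith)).trans hfB
  rcases le_or_gt |u l' k'| (eulerThreshold T (2 ^ j')) with hle | hgt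
  · have h1 := abs_eulerScheme_le hT.le
      (pow_four_mul_le_of_abs_le_eulerThreshold hT (hN j') hle) (2 ^ j')
    exact key ((h1.trans hu4).trans h4B)
  have hyS : (⟨l', k', j'⟩ : Σ _ : ℕ, ℕ × ℕ) ∈ S := by
    rw [hS, Finset.mem_filter]
    exact ⟨hyJ, hwy, hgt⟩
  have hj' : j' ≤ i + 1 := hmax₁ _ hyS
  rcases hj'.lt_or_eq with hlt | rfl
  · apply key
    refine (abs_eulerScheme_le_pow hT.le (one_le_pow₀ (by norm_num)) hu4 (2 ^ j')).trans ?_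
    refine pow_le_pow_right₀ hBbase ?_
    exact Nat.pow_le_pow_right (by norm_num) (Nat.pow_le_pow_right (by norm_num) (by omega))
  · have h1 : |u l' k'| ≤ M := hmax ⟨l', k', i + 1⟩ ⟨hyS, rfl⟩
    have h2 := hu.separated l hln k (hkn hkl) l' hln' k' (hkn hkl') (by
      intro h
      simp only [Prod.mk.injEq] at h
      obtain ⟨rfl, rfl⟩ := h
      exact hne rfl)
    rw [abs_of_nonneg (sub_nonneg.2 h1), le_sub_iff_add_le'] at h2
    have h3 := one_add_mul_le_of_add_le hM4 h2
    have h4 := pow_mul_abs_eulerScheme_le hT.le ha1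
      (le_pow_four_mul_of_eulerThreshold_le_abs hT (hN (i + 1)) hgt.le) h3 (2 ^ (i + 1))
    refine le_trans ?_ h4
    gcongr
    rw [hDsq]
    exact (le_mul_of_one_le_right (by linarith) hB1).trans hDB

lemma one_le_abs_levelWeight {l j : ℕ} (h : levelWeight l j ≠ 0) : 1 ≤ |levelWeight l j| := by
  have : (1 : ℝ) ≤ 2 ^ l := one_le_pow₀ (by norm_num)
  unfold levelWeight at h ⊢
  split_ifs with h1 h2
  · simpa using this
  · simpa using this
  · simp [h1, h2] at h

theorem eventually_le_abs_mlmcEuler {Ω : Type*} {T p : ℝ} (hT : 0 < T) (hp : 0 < p)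
    (ξ : ℕ → ℕ → Ω → ℝ) :
    ∀ᶠ n : ℕ in atTop, ∀ ω, IsSpread T n (fun l k => ξ l k ω) →
      (n : ℝ) ≤ |mlmcEuler T p ξ (2 ^ n) ω| := by
  filter_upwards [eventually_rpow_mul_pow_le T p hT hp, eventually_gt_atTop 0,
    eventually_ge_atTop ⌈T⌉₊] with n hn hn0 hnT ω hω
  have hT8 : T ≤ 8 * n := by
    have := Nat.ceil_le.1 hnT
    have h0 : (0 : ℝ) ≤ n := Nat.cast_nonneg n
    linarith
  set h : ℝ := (2 * 64 ^ n : ℝ) ^ (1 / p) with hh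
  have hh1 : 1 ≤ h := by
    refine Real.one_le_rpow ?_ (by positivity)
    have : (1 : ℝ) ≤ 64 ^ n := one_le_pow₀ (by norm_num)
    linarith
  have hhp : h ^ p = 2 * 64 ^ n := by
    rw [hh, ← Real.rpow_mul (by positivity), one_div_mul_cancel hp.ne', Real.rpow_one]
  obtain ⟨x, hx, hw, hfx, hdom⟩ := hω.exists_dominant hT hT8 hn0 hh1 hn
  set F : (Σ _ : ℕ, ℕ × ℕ) → ℝ := fun x =>
    |eulerScheme T (2 ^ x.2.2) (ξ x.1 x.2.1 ω) (2 ^ x.2.2)| ^ p with hF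
  have hFx : 2 * 64 ^ n ≤ F x := by
    rw [← hhp]
    exact Real.rpow_le_rpow (by linarith) hfx hp.le
  have hmain := half_le_abs_sum (s := mlmcIndex n) (w := fun x => levelWeight x.1 x.2.2) (F := F)
    hx (one_le_abs_levelWeight hw) (by positivity) (by
      intro y hy hyx
      by_cases hwy : levelWeight y.1 y.2.2 = 0
      · rw [hwy, zero_mul, abs_zero, mul_zero]; positivity
      have h1 := Real.rpow_le_rpow (by positivity) (hdom y hy hwy hyx) hp.le
      rw [Real.mul_rpow (by linarith) (abs_nonneg _), hhp] at h1
      have h2 : |levelWeight y.1 y.2.2| ≤ 2 ^ n := by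
        refine abs_levelWeight_le ?_ _
        simp only [mlmcIndex, Finset.mem_sigma, Finset.mem_range] at hy
        omega
      have h3 : ((mlmcIndex n).card : ℝ) ≤ 8 ^ n := by exact_mod_cast card_mlmcIndex_le n
      have h4 : 0 ≤ F y := by positivity
      calc 2 * ((mlmcIndex n).card : ℝ) * |levelWeight y.1 y.2.2 * F y|
          = 2 * ((mlmcIndex n).card : ℝ) * (|levelWeight y.1 y.2.2| * F y) := by
            rw [abs_mul, abs_of_nonneg h4]
        _ ≤ 2 * 8 ^ n * (2 ^ n * F y) := by gcongr
        _ = 2 * 16 ^ n * F y := by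
            rw [show (16 : ℝ) = 8 * 2 by norm_num, mul_pow]; ring
        _ ≤ 2 * 64 ^ n * F y := by gcongr; norm_num
        _ ≤ F x := h1)
  rw [← two_pow_mul_mlmcEuler, abs_mul, abs_of_pos (by positivity : (0 : ℝ) < 2 ^ n)] at hmain
  have h5 : (2 : ℝ) ^ n * n ≤ 2 ^ n * |mlmcEuler T p ξ (2 ^ n) ω| := by
    refine le_trans ?_ hmain
    have h6 : (n : ℝ) ≤ 2 ^ n := by exact_mod_cast (Nat.lt_two_pow_self (n := n)).le
    calc (2 : ℝ) ^ n * n ≤ 2 ^ n * 2 ^ n := by gcongr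
      _ = 4 ^ n := by rw [← mul_pow]; norm_num
      _ ≤ 64 ^ n := by gcongr; norm_num
      _ ≤ F x / 2 := by linarith
  exact le_of_mul_le_mul_left h5 (by positivity)

end Estimator

section Gaussian

open scoped NNReal ENNReal

variable {Ω : Type*} [MeasurableSpace Ω] {P : Measure Ω} {v : ℝ≥0}

lemma gaussianReal_real_Icc_le (m : ℝ) (hv : v ≠ 0) {a b : ℝ} (hab : a ≤ b) :
    (gaussianReal m v).real (Set.Icc a b) ≤ (√(2 * Real.pi * v))⁻¹ * (b - a) := by
  refine ENNReal.toReal_le_of_le_ofReal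
    (mul_nonneg (by positivity) (sub_nonneg.2 hab)) ?_
  rw [gaussianReal_apply m hv]
  calc ∫⁻ x in Set.Icc a b, gaussianPDF m v x
      ≤ ∫⁻ _ in Set.Icc a b, ENNReal.ofReal (√(2 * Real.pi * v))⁻¹ := by
        refine lintegral_mono fun x => ENNReal.ofReal_le_ofReal ?_
        rw [gaussianPDFReal]
        refine mul_le_of_le_one_right (by positivity) (Real.exp_le_one_iff.2 ?_)
        rw [neg_div]
        exact neg_nonpos.2 (by positivity)
    _ = ENNReal.ofReal ((√(2 * Real.pi * v))⁻¹ * (b - a)) := by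
        rw [setLIntegral_const, Real.volume_Icc, ← ENNReal.ofReal_mul (by positivity)]

lemma le_gaussianReal_real_abs_gt (hv : v ≠ 0) {r : ℝ} (hr : 0 ≤ r) :
    (√(2 * Real.pi * v))⁻¹ * Real.exp (-(r + 1) ^ 2 / (2 * v)) ≤
      (gaussianReal 0 v).real {x | r < |x|} := by
  refine le_trans ?_ (measureReal_mono (s₁ := Set.Ioc r (r + 1)) fun x hx => ?_)
  · refine (ENNReal.ofReal_le_iff_le_toReal (measure_ne_top _ _)).1 ?_
    rw [gaussianReal_apply 0 hv]
    calc ENNReal.ofReal ((√(2 * Real.pi * v))⁻¹ * Real.exp (-(r + 1) ^ 2 / (2 * v)))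
        = ∫⁻ _ in Set.Ioc r (r + 1),
            ENNReal.ofReal ((√(2 * Real.pi * v))⁻¹ * Real.exp (-(r + 1) ^ 2 / (2 * v))) := by
          rw [setLIntegral_const, Real.volume_Ioc]; simp
      _ ≤ ∫⁻ x in Set.Ioc r (r + 1), gaussianPDF 0 v x := by
          refine setLIntegral_mono' measurableSet_Ioc fun x hx => ENNReal.ofReal_le_ofReal ?_
          rw [gaussianPDFReal, sub_zero]
          have h1 : x ^ 2 ≤ (r + 1) ^ 2 := pow_le_pow_left₀ (hr.trans hx.1.le) hx.2 2
          gcongr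
  · exact hx.1.trans_le (le_abs_self x)

lemma measureReal_abs_sub_le_le (hv : v ≠ 0) {X : Ω → ℝ}
    (hX : HasLaw X (gaussianReal 0 v) P) (c : ℝ) {ε : ℝ} (hε : 0 ≤ ε) :
    P.real {ω | |X ω - c| ≤ ε} ≤ (√(2 * Real.pi * v))⁻¹ * (2 * ε) := by
  have h1 : {x : ℝ | |x - c| ≤ ε} = Set.Icc (c - ε) (c + ε) := by
    ext x
    rw [Set.mem_ofPred_eq, Set.mem_Icc, abs_le]
    constructor <;> rintro ⟨h, h'⟩ <;> constructor <;> linarith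
  rw [hX.measureReal_eq (p := fun x => |x - c| ≤ ε) (by rw [h1]; exact measurableSet_Icc), h1]
  refine (gaussianReal_real_Icc_le 0 hv (by linarith)).trans_eq ?_
  ring

lemma measureReal_abs_abs_sub_lt_le (hv : v ≠ 0) [IsFiniteMeasure P] {X : Ω → ℝ}
    (hX : HasLaw X (gaussianReal 0 v) P) (c : ℝ) {ε : ℝ} (hε : 0 ≤ ε) :
    P.real {ω | |(|X ω| - c)| < ε} ≤ 4 * (√(2 * Real.pi * v))⁻¹ * ε := by
  have h : {ω | |(|X ω| - c)| < ε} ⊆ {ω | |X ω - c| ≤ ε} ∪ {ω | |X ω - -c| ≤ ε} := by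
    intro ω hω
    rw [Set.mem_ofPred_eq] at hω
    rcases abs_cases (X ω) with ⟨h1, _⟩ | ⟨h1, _⟩ <;> rw [h1] at hω
    · exact Or.inl hω.le
    · right
      rw [Set.mem_ofPred_eq, ← abs_neg, show -(X ω - -c) = -X ω - c by ring]
      exact hω.le
  have h1 := measureReal_abs_sub_le_le hv hX c hε
  have h2 := measureReal_abs_sub_le_le hv hX (-c) hε
  calc _ ≤ _ := measureReal_mono h
    _ ≤ _ := measureReal_union_le _ _
    _ ≤ _ := add_le_add h1 h2
    _ = _ := by ring

lemma measureReal_abs_abs_sub_abs_lt_le (hv : v ≠ 0) [IsFiniteMeasure P] {X Y : Ω → ℝ}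
    (hX : HasLaw X (gaussianReal 0 v) P) (hY : HasLaw Y (gaussianReal 0 v) P)
    (hXY : IndepFun X Y P) {ε : ℝ} (hε : 0 ≤ ε) :
    P.real {ω | |(|X ω| - |Y ω|)| < ε} ≤ 4 * (√(2 * Real.pi * (v + v : ℝ≥0)))⁻¹ * ε := by
  have hY' : HasLaw (-Y) (gaussianReal 0 v) P := by
    simpa using gaussianReal_neg hY
  have hadd : HasLaw (X + Y) (gaussianReal 0 (v + v)) P :=
    ⟨hX.aemeasurable.add hY.aemeasurable, by
      simpa using gaussianReal_add_gaussianReal_of_indepFun hXY hX.map_eq hY.map_eq⟩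
  have hsub : HasLaw (X + -Y) (gaussianReal 0 (v + v)) P :=
    ⟨hX.aemeasurable.add hY'.aemeasurable, by
      have h : IndepFun X (-Y) P := hXY.comp measurable_id measurable_neg
      simpa using gaussianReal_add_gaussianReal_of_indepFun h hX.map_eq hY'.map_eq⟩
  have hvv : v + v ≠ 0 := by simpa using hv
  have h : {ω | |(|X ω| - |Y ω|)| < ε} ⊆
      {ω | |(X + Y) ω - 0| ≤ ε} ∪ {ω | |(X + -Y) ω - 0| ≤ ε} := by
    intro ω hω
    rw [Set.mem_ofPred_eq] at hω
    simp only [Set.mem_union, Set.mem_ofPred_eq, sub_zero, Pi.add_apply, Pi.neg_apply]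
    rw [abs_lt] at hω
    simp only [abs_le]
    rcases abs_cases (X ω) with ⟨h1, _⟩ | ⟨h1, _⟩ <;>
      rcases abs_cases (Y ω) with ⟨h2, _⟩ | ⟨h2, _⟩ <;> rw [h1, h2] at hω
    · right; constructor <;> linarith
    · left; constructor <;> linarith
    · left; constructor <;> linarith
    · right; constructor <;> linarith
  have h1 := measureReal_abs_sub_le_le hvv hadd 0 hε
  have h2 := measureReal_abs_sub_le_le hvv hsub 0 hε
  calc _ ≤ _ := measureReal_mono h
    _ ≤ _ := measureReal_union_le _ _
    _ ≤ _ := add_le_add h1 h2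
    _ = _ := by ring

lemma measureReal_abs_gt_le [IsProbabilityMeasure P] {X : Ω → ℝ}
    (hX : HasLaw X (gaussianReal 0 v) P) {c : ℝ} (hc : 0 < c) :
    P.real {ω | c < |X ω|} ≤ v / c ^ 2 := by
  rw [hX.measureReal_eq (p := fun x => c < |x|) (measurableSet_lt measurable_const measurable_id.abs)]
  refine ENNReal.toReal_le_of_le_ofReal (by positivity) ?_
  have h := meas_ge_le_variance_div_sq (memLp_id_gaussianReal' (μ := 0) (v := v) 2 (by simp)) hc
  rw [variance_id_gaussianReal] at h
  refine (measure_mono fun x hx => ?_).trans h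
  have h0 : ∫ x, id x ∂gaussianReal 0 v = 0 := integral_id_gaussianReal
  rw [Set.mem_ofPred_eq, h0, sub_zero]
  exact le_of_lt hx

end Gaussian

section BorelCantelli

variable {Ω : Type*} [MeasurableSpace Ω] {P : Measure Ω} [IsProbabilityMeasure P]

lemma ae_eventually_notMem_of_eventually_le {s : ℕ → Set Ω} {b : ℕ → ℝ} (hb : Summable b)
    (h : ∀ᶠ n in atTop, P.real (s n) ≤ b n) : ∀ᵐ ω ∂P, ∀ᶠ n in atTop, ω ∉ s n := by
  obtain ⟨N, hN⟩ := eventually_atTop.1 h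
  have h1 : ∑' n, P (s (n + N)) ≠ ⊤ := by
    refine ne_top_of_le_ne_top ((summable_nat_add_iff N).2 hb).tsum_ofReal_ne_top ?_
    refine ENNReal.tsum_le_tsum fun n => ?_
    rw [← ofReal_measureReal]
    exact ENNReal.ofReal_le_ofReal (hN _ (Nat.le_add_left _ _))
  filter_upwards [ae_eventually_notMem h1] with ω hω
  rw [← map_add_atTop_eq_nat N]
  exact hω

lemma ae_eventually_forall_notMem {ι : Type*} {I : ℕ → Finset ι} {A : ℕ → ι → Set Ω} {C : ℝ}
    {c : ℕ} (hc : 0 < c) (hI : ∀ n, (I n).card ≤ c ^ n)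
    (hA : ∀ n, ∀ i ∈ I n, P.real (A n i) ≤ C * (1 / (2 * c)) ^ n) :
    ∀ᵐ ω ∂P, ∀ᶠ n in atTop, ∀ i ∈ I n, ω ∉ A n i := by
  have hc' : (c : ℝ) ≠ 0 := by exact_mod_cast hc.ne'
  have hb : Summable fun n : ℕ => |C| * (1 / 2 : ℝ) ^ n :=
    summable_geometric_two.mul_left _
  have h := ae_eventually_notMem_of_eventually_le (P := P) (s := fun n => ⋃ i ∈ I n, A n i) hb
    (Eventually.of_forall fun n => ?_)
  · filter_upwards [h] with ω hω
    filter_upwards [hω] with n hn i hi hmem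
    exact hn (Set.mem_biUnion hi hmem)
  · calc P.real (⋃ i ∈ I n, A n i) ≤ ∑ i ∈ I n, P.real (A n i) :=
          measureReal_biUnion_finset_le _ _
      _ ≤ ∑ i ∈ I n, |C| * (1 / (2 * c)) ^ n := by
          refine Finset.sum_le_sum fun i hi => (hA n i hi).trans ?_
          gcongr
          exact le_abs_self C
      _ = (I n).card * (|C| * (1 / (2 * c)) ^ n) := by rw [Finset.sum_const, nsmul_eq_mul]
      _ ≤ (c : ℝ) ^ n * (|C| * (1 / (2 * c)) ^ n) := by
          gcongr
          exact_mod_cast hI n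
      _ = |C| * (1 / 2) ^ n := by
          rw [mul_left_comm, ← mul_pow]
          congr 2
          field_simp

end BorelCantelli

section Exceedance

open scoped NNReal ENNReal

variable {Ω : Type*} [MeasurableSpace Ω] {P : Measure Ω} {v : ℝ≥0}

lemma measureReal_forall_abs_le_le {X : ℕ → Ω → ℝ}
    (hX : ∀ k, HasLaw (X k) (gaussianReal 0 v) P) (hindep : iIndepFun X P) (m : ℕ) (r : ℝ) :
    P.real {ω | ∀ k < m, |X k ω| ≤ r} ≤
      Real.exp (-(m * (gaussianReal 0 v).real {x | r < |x|})) := by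
  have hms : MeasurableSet {x : ℝ | r < |x|} := measurableSet_lt measurable_const measurable_id.abs
  have h1 : {ω | ∀ k < m, |X k ω| ≤ r} =
      ⋂ k ∈ Finset.range m, X k ⁻¹' {x | r < |x|}ᶜ := by
    ext ω; simp
  have h2 : ∀ k, P (X k ⁻¹' {x | r < |x|}ᶜ) =
      ENNReal.ofReal (1 - (gaussianReal 0 v).real {x | r < |x|}) := by
    intro k
    rw [← Measure.map_apply_of_aemeasurable (hX k).aemeasurable hms.compl, (hX k).map_eq,
      ← probReal_compl_eq_one_sub hms, ofReal_measureReal]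
  have h3 : (gaussianReal 0 v).real {x | r < |x|} ≤ 1 := measureReal_le_one
  rw [measureReal_def, h1, hindep.measure_inter_preimage_eq_mul _ (fun _ _ => hms.compl),
    Finset.prod_congr rfl fun k _ => h2 k, Finset.prod_const, Finset.card_range,
    ENNReal.toReal_pow, ENNReal.toReal_ofReal (by linarith), ← mul_neg, Real.exp_nat_mul]
  refine pow_le_pow_left₀ (by linarith) ?_ m
  linarith [Real.add_one_le_exp (-(gaussianReal 0 v).real {x | r < |x|})]

lemma eulerThreshold_sq_le {T s : ℝ} (hT : 0 < T) (hs : 0 < s) {N n : ℕ} (hN : N ≤ 16 * n) :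
    eulerThreshold T N ^ 2 / s ≤ n / 4 + 32 / (T * s ^ 2) := by
  have hN' : (N : ℝ) ≤ 16 * n := by exact_mod_cast hN
  have h1 : √(2 * N / T) ≤ s * (n / 4 + 32 / (T * s ^ 2)) := by
    refine Real.sqrt_le_iff.2 ⟨by positivity, ?_⟩
    calc 2 * (N : ℝ) / T ≤ 2 * (16 * n) / T := by gcongr
      _ = s ^ 2 * (4 * (n / 4) * (32 / (T * s ^ 2))) := by field_simp; ring
      _ ≤ s ^ 2 * (n / 4 + 32 / (T * s ^ 2)) ^ 2 := by
          gcongr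
          exact four_mul_le_sq_add _ _
      _ = _ := by ring
  rw [eulerThreshold, Real.sq_sqrt (Real.sqrt_nonneg _), div_le_iff₀' hs]
  exact h1

lemma eventually_le_two_pow_mul_gaussianReal {T : ℝ} (hT : 0 < T) (hv : v ≠ 0) :
    ∀ᶠ n : ℕ in atTop, ∀ l ≤ n, 2 ^ l ≤ 16 * n →
      (n : ℝ) ≤ (2 ^ (n - l) : ℕ) *
        (gaussianReal 0 v).real {x | eulerThreshold T (2 ^ l) < |x|} := by
  have hv0 : (0 : ℝ) < v := by positivity
  set C : ℝ := (√(2 * Real.pi * v))⁻¹ * Real.exp (-(32 / (T * v ^ 2) + 1 / v)) with hC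
  have hCpos : 0 < C := by positivity
  have hexp : Real.exp (1 / 4) < 2 := by
    have h1 : Real.exp (1 / 4) ^ 4 < 2 ^ 4 := by
      rw [← Real.exp_nat_mul]
      norm_num
      linarith [Real.exp_one_lt_d9]
    exact lt_of_pow_lt_pow_left₀ 4 (by norm_num) h1
  have hlim := tendsto_pow_const_mul_const_pow_of_lt_one 2
    (r := Real.exp (1 / 4) / 2) (by positivity) (by linarith)
  filter_upwards [hlim.eventually (gt_mem_nhds (show (0 : ℝ) < C / 16 by positivity)),
    eventually_gt_atTop 0] with n hn hn0 l hl hln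
  have hn0' : (0 : ℝ) < n := by exact_mod_cast hn0
  have hr := eulerThreshold_nonneg T (2 ^ l)
  have h1 := le_gaussianReal_real_abs_gt hv hr
  have h2 := eulerThreshold_sq_le hT hv0 hln
  have h3 : C * Real.exp (-(n / 4)) ≤
      (gaussianReal 0 v).real {x | eulerThreshold T (2 ^ l) < |x|} := by
    refine le_trans ?_ h1
    rw [hC, mul_assoc, ← Real.exp_add]
    gcongr
    have h4 : (eulerThreshold T (2 ^ l) + 1) ^ 2 / (2 * v) ≤
        eulerThreshold T (2 ^ l) ^ 2 / v + 1 / v := by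
      rw [← add_div, div_le_div_iff₀ (by positivity) hv0]
      nlinarith [sq_nonneg (eulerThreshold T (2 ^ l) - 1)]
    rw [neg_div]
    linarith
  have h5 : (2 : ℝ) ^ n / (16 * n) ≤ (2 ^ (n - l) : ℕ) := by
    have h6 : (2 : ℝ) ^ l ≤ 16 * n := by exact_mod_cast hln
    rw [div_le_iff₀ (by positivity)]
    push_cast
    calc (2 : ℝ) ^ n = 2 ^ (n - l) * 2 ^ l := by rw [← pow_add, Nat.sub_add_cancel hl]
      _ ≤ _ := by gcongr
  refine le_trans ?_ (mul_le_mul h5 h3 (by positivity) (by positivity))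
  have h7 : Real.exp (-(n / 4)) * Real.exp (1 / 4) ^ n = 1 := by
    rw [← Real.exp_nat_mul, ← Real.exp_add]
    simp; ring
  rw [div_pow, ← mul_div_assoc, div_lt_iff₀ (by positivity)] at hn
  have h8 : (n : ℝ) * (16 * n) ≤ 2 ^ n * (C * Real.exp (-(n / 4))) := by
    calc (n : ℝ) * (16 * n)
        = 16 * ((n : ℝ) ^ 2 * Real.exp (1 / 4) ^ n) * Real.exp (-(n / 4)) := by
          rw [mul_assoc, mul_assoc, mul_comm (Real.exp _ ^ n), h7]; ring
      _ ≤ 16 * (C / 16 * 2 ^ n) * Real.exp (-(n / 4)) := by gcongr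
      _ = _ := by ring
  rw [div_mul_eq_mul_div, le_div_iff₀ (by positivity)]
  exact h8

lemma eventually_exists_level : ∀ᶠ n : ℕ in atTop, ∃ l ≤ n, 8 * n ≤ 2 ^ l ∧ 2 ^ l ≤ 16 * n := by
  filter_upwards [eventually_ge_atTop 6] with n hn
  have h8 : 8 * n ≤ 2 ^ n := by
    induction n, hn using Nat.le_induction with
    | base => norm_num
    | succ n hn ih => rw [pow_succ]; omega
  refine ⟨Nat.clog 2 (8 * n), Nat.clog_le_of_le_pow h8, Nat.le_pow_clog (by norm_num) _, ?_⟩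
  have h1 := Nat.pow_pred_clog_lt_self (b := 2) (by norm_num) (x := 8 * n) (by omega)
  have h2 : 0 < Nat.clog 2 (8 * n) := Nat.clog_pos (by norm_num) (by omega)
  obtain ⟨m, hm⟩ := Nat.exists_eq_succ_of_ne_zero h2.ne'
  rw [hm] at h1 ⊢
  simp only [Nat.succ_eq_add_one, Nat.pred_succ, pow_succ] at h1 ⊢
  omega

variable [IsProbabilityMeasure P]

lemma ae_eventually_exceeds {T : ℝ} (hT : 0 < T) (hv : v ≠ 0) {ξ : ℕ → ℕ → Ω → ℝ}
    (hξ : ∀ l k, HasLaw (ξ l k) (gaussianReal 0 v) P)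
    (hindep : iIndepFun (fun i : ℕ × ℕ => ξ i.1 i.2) P) :
    ∀ᵐ ω ∂P, ∀ᶠ n : ℕ in atTop, ∃ l ≤ n, 8 * n ≤ 2 ^ l ∧
      ∃ k < 2 ^ (n - l), eulerThreshold T (2 ^ l) < |ξ l k ω| := by
  have hb : Summable fun n : ℕ => Real.exp (-(n : ℝ)) := Real.summable_exp_neg_nat
  have h := ae_eventually_notMem_of_eventually_le (P := P) (s := fun n => {ω | ∀ l ≤ n,
    8 * n ≤ 2 ^ l → ∀ k < 2 ^ (n - l), |ξ l k ω| ≤ eulerThreshold T (2 ^ l)}) hb ?_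
  · filter_upwards [h] with ω hω
    filter_upwards [hω] with n hn
    by_contra! hcon
    exact hn hcon
  · filter_upwards [eventually_le_two_pow_mul_gaussianReal hT hv, eventually_exists_level]
      with n hn ⟨l, hl, hl8, hl16⟩
    have hsub : {ω | ∀ l ≤ n, 8 * n ≤ 2 ^ l → ∀ k < 2 ^ (n - l),
        |ξ l k ω| ≤ eulerThreshold T (2 ^ l)} ⊆
        {ω | ∀ k < 2 ^ (n - l), |ξ l k ω| ≤ eulerThreshold T (2 ^ l)} := by
      intro ω hω
      rw [Set.mem_ofPred_eq] at hω ⊢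
      exact hω l hl hl8
    refine (measureReal_mono hsub).trans ?_
    have hind : iIndepFun (ξ l) P :=
      hindep.precomp (g := fun k => (l, k)) fun a b hab => (Prod.mk.inj hab).2
    refine (measureReal_forall_abs_le_le (hξ l) hind _ _).trans ?_
    exact Real.exp_le_exp.2 (neg_le_neg (hn l hl hl16))

lemma ae_eventually_isSpread {T : ℝ} (hT : 0 < T) (hv : v ≠ 0) {ξ : ℕ → ℕ → Ω → ℝ}
    (hξ : ∀ l k, HasLaw (ξ l k) (gaussianReal 0 v) P)
    (hindep : iIndepFun (fun i : ℕ × ℕ => ξ i.1 i.2) P) :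
    ∀ᵐ ω ∂P, ∀ᶠ n : ℕ in atTop, IsSpread T n (fun l k => ξ l k ω) := by
  set I : ℕ → Finset (ℕ × ℕ) := fun n => Finset.range (n + 1) ×ˢ Finset.range (2 ^ n) with hI
  have hle : ∀ n, n + 1 ≤ 2 ^ n := fun n => Nat.lt_two_pow_self
  have hcard : ∀ n, (I n).card ≤ 4 ^ n := fun n => by
    rw [hI, Finset.card_product, Finset.card_range, Finset.card_range,
      show 4 = 2 * 2 from rfl, mul_pow]
    exact Nat.mul_le_mul_right _ (hle n)
  have hmem : ∀ {n l k}, l ≤ n → k < 2 ^ n → (l, k) ∈ I n := fun hl hk =>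
    Finset.mk_mem_product (Finset.mem_range.2 (Nat.lt_succ_of_le hl)) (Finset.mem_range.2 hk)
  have hbound := ae_eventually_forall_notMem (P := P) (I := I)
    (A := fun n i => {ω | 4 ^ n < |ξ i.1 i.2 ω|}) (C := v) (c := 4) (by norm_num) hcard
    fun n i _ => by
      refine (measureReal_abs_gt_le (hξ i.1 i.2) (by positivity)).trans ?_
      rw [div_eq_mul_inv, ← pow_mul, mul_comm n, pow_mul, ← inv_pow]
      gcongr
      norm_num
  have hsep := ae_eventually_forall_notMem (P := P)
    (I := fun n => ((I n) ×ˢ (I n)).filter fun q => q.1 ≠ q.2)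
    (A := fun n q => {ω | |(|ξ q.1.1 q.1.2 ω| - |ξ q.2.1 q.2.2 ω|)| < (1 / 32) ^ n})
    (C := 4 * (√(2 * Real.pi * (v + v : ℝ≥0)))⁻¹) (c := 16) (by norm_num)
    (fun n => by
      refine (Finset.card_filter_le _ _).trans ?_
      rw [Finset.card_product, show 16 = 4 * 4 from rfl, mul_pow]
      exact Nat.mul_le_mul (hcard n) (hcard n))
    fun n q hq => by
      have hne := (Finset.mem_filter.1 hq).2
      refine (measureReal_abs_abs_sub_abs_lt_le hv (hξ _ _) (hξ _ _)
        (hindep.indepFun hne) (by positivity)).trans_eq ?_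
      norm_num
  have hthr := ae_eventually_forall_notMem (P := P)
    (I := fun n => (Finset.range (n + 1)) ×ˢ (I n))
    (A := fun n q => {ω | |(|ξ q.2.1 q.2.2 ω| - eulerThreshold T (2 ^ q.1))| < (1 / 32) ^ n})
    (C := 4 * (√(2 * Real.pi * v))⁻¹) (c := 16) (by norm_num)
    (fun n => by
      rw [Finset.card_product, Finset.card_range, show 16 = 4 * 4 from rfl, mul_pow]
      exact Nat.mul_le_mul ((hle n).trans (Nat.pow_le_pow_left (by norm_num) n)) (hcard n))
    fun n q _ => by
      refine (measureReal_abs_abs_sub_lt_le hv (hξ _ _) _ (by positivity)).trans_eq ?_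
      norm_num
  filter_upwards [hbound, hsep, hthr, ae_eventually_exceeds hT hv hξ hindep] with ω h1 h2 h3 h4
  filter_upwards [h1, h2, h3, h4] with n h1 h2 h3 h4
  refine ⟨fun l hl k hk => ?_, fun l hl k hk l' hl' k' hk' hne => ?_, fun j hj l hl k hk => ?_, h4⟩
  · exact not_lt.1 (h1 (l, k) (hmem hl hk))
  · exact not_lt.1 (h2 ((l, k), (l', k')) (Finset.mem_filter.2
      ⟨Finset.mk_mem_product (hmem hl hk) (hmem hl' hk'), hne⟩))
  · exact not_lt.1 (h3 (j, (l, k)) (Finset.mk_mem_product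
      (Finset.mem_range.2 (Nat.lt_succ_of_le hj)) (hmem hl hk)))

end Exceedance

section Solution

lemma abs_le_abs_of_eq_add_integral {T a : ℝ} (hT : 0 ≤ T) {f : ℝ → ℝ}
    (hf : ContinuousOn f (Set.Icc 0 T))
    (h : ∀ t ∈ Set.Icc (0 : ℝ) T, f t = a + ∫ s in (0 : ℝ)..t, -(f s) ^ 5) :
    |f T| ≤ |a| := by
  have h0 : f 0 = a := by simpa using h 0 ⟨le_rfl, hT⟩
  have hder : ∀ t ∈ Set.Ioo (0 : ℝ) T, HasDerivAt f (-(f t) ^ 5) t := by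
    intro t ht
    have hg : ContinuousOn (fun s => -(f s) ^ 5) (Set.Icc 0 T) := (hf.pow 5).neg
    have hnhds : Set.Icc (0 : ℝ) T ∈ 𝓝 t := Icc_mem_nhds ht.1 ht.2
    have h1 : HasDerivAt (fun t => a + ∫ s in (0 : ℝ)..t, -(f s) ^ 5) (-(f t) ^ 5) t := by
      refine HasDerivAt.const_add a (intervalIntegral.integral_hasDerivAt_right ?_ ?_ ?_)
      · refine ContinuousOn.intervalIntegrable (hg.mono ?_)
        rw [Set.uIcc_of_le ht.1.le]
        exact Set.Icc_subset_Icc_right ht.2.le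
      · exact (hg.mono Set.Ioo_subset_Icc_self).stronglyMeasurableAtFilter isOpen_Ioo t ht
      · exact hg.continuousAt hnhds
    refine h1.congr_of_eventuallyEq ?_
    filter_upwards [hnhds] with s hs using h s hs
  have hanti : AntitoneOn (fun t => f t ^ 2) (Set.Icc 0 T) := by
    refine antitoneOn_of_hasDerivWithinAt_nonpos (convex_Icc 0 T) (hf.pow 2)
      (f' := fun t => 2 * f t * -(f t) ^ 5) (fun t ht => ?_) fun t _ => ?_
    · rw [interior_Icc] at ht
      have := (hder t ht).fun_pow 2
      simpa using this.hasDerivWithinAt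
    · have : 2 * f t * -(f t) ^ 5 = -(2 * (f t ^ 3) ^ 2) := by ring
      rw [this]
      exact neg_nonpos.2 (by positivity)
  have h1 := hanti ⟨le_rfl, hT⟩ ⟨hT, le_rfl⟩ hT
  simp only [h0] at h1
  exact sq_le_sq.1 h1

open scoped NNReal in
lemma IsQuinticSolution.integrable_abs_rpow {Ω : Type*} [MeasurableSpace Ω] {P : Measure Ω}
    {T : ℝ} (hT : 0 ≤ T) {ξ₀ : Ω → ℝ} {X : ℝ → Ω → ℝ} (hX : IsQuinticSolution P T ξ₀ X) {v : ℝ≥0}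
    (hξ₀ : HasLaw ξ₀ (gaussianReal 0 v) P) {p : ℝ} (hp : 0 < p) :
    Integrable (fun ω => |X T ω| ^ p) P := by
  have h1 : Integrable (fun x : ℝ => |x| ^ p) (gaussianReal 0 v) := by
    have := (memLp_id_gaussianReal' (μ := 0) (v := v) (ENNReal.ofReal p)
      ENNReal.ofReal_ne_top).integrable_norm_rpow (by simpa using hp) ENNReal.ofReal_ne_top
    simpa [ENNReal.toReal_ofReal hp.le] using this
  have h2 : Integrable (fun ω => |ξ₀ ω| ^ p) P := by
    rw [← hξ₀.map_eq] at h1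
    exact h1.comp_aemeasurable hξ₀.aemeasurable
  have hm := hX.measurable T ⟨hT, le_rfl⟩
  refine h2.mono' (hm.abs.pow_const p).aestronglyMeasurable ?_
  filter_upwards [hX.integral_eq] with ω hω
  rw [Real.norm_of_nonneg (by positivity)]
  exact Real.rpow_le_rpow (abs_nonneg _)
    (abs_le_abs_of_eq_add_integral hT (hX.continuousOn ω) hω) hp.le

end Solution

lemma not_tendstoInMeasure_of_tendsto_abs_atTop {Ω : Type*} [MeasurableSpace Ω] {P : Measure Ω}
    [NeZero P] {f : ℕ → Ω → ℝ} {g : Ω → ℝ}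
    (h : ∀ᵐ ω ∂P, Tendsto (fun n => |f n ω|) atTop atTop) : ¬ TendstoInMeasure P f atTop g := by
  intro hfg
  obtain ⟨ns, hns, hlim⟩ := hfg.exists_seq_tendsto_ae
  obtain ⟨ω, h1, h2⟩ := (h.and hlim).exists
  exact not_tendsto_nhds_of_tendsto_atTop (h1.comp hns.tendsto_atTop) _ h2.abs

theorem mainTheorem1 {Ω : Type*} [MeasurableSpace Ω] (P : Measure Ω) [IsProbabilityMeasure P]
    (T σ : ℝ) (hT : 0 < T) (hσ : 0 < σ)
    (ξ : ℕ → ℕ → Ω → ℝ) (hξ_meas : ∀ l k, Measurable (ξ l k))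
    (hξ_law : ∀ l k, HasLaw (ξ l k) (gaussianReal 0 (Real.toNNReal (σ ^ 2))) P)
    (hξ_indep : iIndepFun (fun (i : ℕ × ℕ) => ξ i.1 i.2) P)
    (ξ₀ : Ω → ℝ) (hξ₀_meas : Measurable ξ₀)
    (hξ₀_law : HasLaw ξ₀ (gaussianReal 0 (Real.toNNReal (σ ^ 2))) P)
    (X : ℝ → Ω → ℝ) (hX : IsQuinticSolution P T ξ₀ X)
    (p : ℝ) (hp : 0 < p) :
    (∀ᵐ ω ∂P, Tendsto (fun n : ℕ => |mlmcEuler T p ξ (2 ^ n) ω|) atTop atTop) ∧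
    Integrable (fun ω => |X T ω| ^ p) P ∧
    ¬ TendstoInMeasure P (fun n : ℕ => mlmcEuler T p ξ (2 ^ n)) atTop
        (fun _ => ∫ ω, |X T ω| ^ p ∂P) := by
  have hv : Real.toNNReal (σ ^ 2) ≠ 0 := (Real.toNNReal_pos.2 (by positivity)).ne'
  have hdiv : ∀ᵐ ω ∂P, Tendsto (fun n : ℕ => |mlmcEuler T p ξ (2 ^ n) ω|) atTop atTop := by
    filter_upwards [ae_eventually_isSpread hT hv hξ_law hξ_indep] with ω hω
    refine tendsto_atTop_mono' atTop ?_ (tendsto_natCast_atTop_atTop (R := ℝ))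
    filter_upwards [hω, eventually_le_abs_mlmcEuler hT hp ξ] with n hn h
    exact h ω hn
  exact ⟨hdiv, hX.integrable_abs_rpow hT.le hξ₀_law hp,
    not_tendstoInMeasure_of_tendsto_abs_atTop hdiv⟩
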